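/- Conventions: $\mathbb N=\{1,2,3,\dots\}$, $\mathbb N_0=\mathbb N\cup\{0\}$, $\langle a\rangle=\{0,1,\dots,a-1\}$ for $a\in\mathbb N$. Sums of sets are Minkowski sums, an empty sum of sets being $\{0\}$, and for a set $S$ and numbers $c,r$ we write $cS+r=\{cs+r : s\in S\}$. Let $m\in\mathbb N$. Finite non-empty sets $A_1,\dots,A_m\subset\mathbb N_0$ form an ($m$-part) *sum system* if $A_1+\dots+A_m=\langle N\rangle$, where $N=\prod_{j=1}^m|A_j|$. Finite sets $C_1,\dots,C_m\subset\frac12\mathbb Z$ form a *centred sum system* if there is a sum system $A_1,\dots,A_m$ with $C_j=A_j-\frac{\max A_j}{2}$ for all $j$. A *joint ordered factorisation* of $(n_1,\dots,n_m)\in\mathbb N^m$ is a finite sequence $((j_1,f_1),\dots,(j_L,f_L))$ with $j_\ell\in\{1,\dots,m\}$ and integers $f_\ell\ge 2$ such that $j_\ell\ne j_{\ell-1}$ for $2\le\ell\le L$ and $\prod_{\ell:\,j_\ell=j}f_\ell=n_j$ for every $j\in\{1,\dots,m\}$. (If $n_j=1$ then no $j_\ell$ equals $j$; if all $n_j=1$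 then $L=0$.) Put $F(\ell)=\prod_{s=1}^{\ell-1}f_s$. **Corollary.** Suppose $C_1,\dots,C_m$ form a centred sum system, and let $n_j=|C_j|$. Then there is a joint ordered factorisation $((j_1,f_1),\dots,(j_L,f_L))$ of $(n_1,\dots,n_m)$ such that, for all $j\in\{1,\dots,m\}$, $$C_j=\sum_{\ell:\,j_\ell=j}F(\ell)\Bigl(\langle f_\ell\rangle-\frac{f_\ell-1}{2}\Bigr)=\frac12\sum_{\ell:\,j_\ell=j}F(\ell)\bigl(2\langle f_\ell\rangle-(f_\ell-1)\bigr).\qquad(*)$$ Conversely, for every $(n_1,\dots,n_m)\in\mathbb N^m$ and every joint ordered factorisation of it, the two expressions in $(*)$ agree, and the sets $C_1,\dots,C_m$ that they define form a centred sum system with $|C_j|=n_j$ for all $j$. -/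

import Mathlib

open scoped Pointwise

/-- Finite non-empty sets `A_1, …, A_m` of non-negative integers form an `m`-part sum system if
their set sum (Minkowski sum) is `{0, 1, …, N - 1}`, where `N = |A_1| ⋯ |A_m|`. -/
structure IsSumSystem {m : ℕ} (A : Fin m → Finset ℕ) : Prop where
  nonempty : ∀ j, (A j).Nonempty
  sum_eq : ∑ j, A j = Finset.range (∏ j, (A j).card)

/-- `C_1, …, C_m` form a centred sum system if `C_j = A_j - (max A_j) / 2` for some sum system
`A_1, …, A_m`. The elements are integers or half-integers, so they live in `ℚ`. -/
def IsCentredSumSystem {m : ℕ} (C : Fin m → Finset ℚ) : Prop :=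
  ∃ (A : Fin m → Finset ℕ) (h : IsSumSystem A),
    ∀ j, C j = (A j).image fun a : ℕ => (a : ℚ) - ((A j).max' (h.nonempty j) : ℚ) / 2

/-- A joint ordered factorisation `((j_1, f_1), …, (j_L, f_L))` of `n = (n_1, …, n_m)`: all
factors are at least `2`, neighbouring factors belong to different indices, and the factors that
belong to `i` have product `n_i`. When all `n_i ≥ 2` every `i` occurs among the `j_ℓ`; an index
with `n_i = 1` is allowed and has no factors, as the empty product is `1`. -/
structure JointOrderedFactorisation {m : ℕ} (n : Fin m → ℕ) where
  /-- The number of factors. -/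
  L : ℕ
  /-- The index to which a factor belongs. -/
  j : Fin L → Fin m
  /-- The factors. -/
  f : Fin L → ℕ
  two_le : ∀ l, 2 ≤ f l
  adjacent_ne : ∀ k l : Fin L, (l : ℕ) = (k : ℕ) + 1 → j l ≠ j k
  prod_eq : ∀ i, ∏ l with j l = i, f l = n i

namespace JointOrderedFactorisation

variable {m : ℕ} {n : Fin m → ℕ}

/-- The product `F(ℓ)` of all factors that precede the factor at position `ℓ`. -/
def F (P : JointOrderedFactorisation n) (l : Fin P.L) : ℕ := ∏ s ∈ Finset.Iio l, P.f s

/-- The set `∑_{ℓ : j_ℓ = i} F(ℓ) (⟨f_ℓ⟩ - (f_ℓ - 1) / 2)`, a set sum (an empty one is `{0}`),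
where `⟨a⟩ = {0, …, a - 1}`. -/
def centredSet (P : JointOrderedFactorisation n) (i : Fin m) : Finset ℚ :=
  ∑ l with P.j l = i,
    (Finset.range (P.f l)).image fun k : ℕ => (P.F l : ℚ) * ((k : ℚ) - ((P.f l : ℚ) - 1) / 2)

/-- The set `(1 / 2) ∑_{ℓ : j_ℓ = i} F(ℓ) (2 ⟨f_ℓ⟩ - (f_ℓ - 1))`. -/
def halvedSet (P : JointOrderedFactorisation n) (i : Fin m) : Finset ℚ :=
  (∑ l with P.j l = i,
    (Finset.range (P.f l)).image fun k : ℕ =>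
      (P.F l : ℚ) * (2 * (k : ℚ) - ((P.f l : ℚ) - 1))).image fun x => (1 / 2 : ℚ) * x

end JointOrderedFactorisation

/-!
A sum system represents every number of its sum exactly once, since there are only as many tuples
as sums (`IsSumSystem.add_injOn`). All parts contain `0`, and if the system is non-trivial, some
part `A i₀` contains `1`. Let `f ≥ 2` be the least number outside `A i₀`, and cut the natural
numbers into blocks of length `f`. Unique representation forces every block either to lie in
`A i₀` or to miss it, and the other parts to consist of multiples of `f` (`block_structure`, by
induction on the block). Dividing by `f` therefore leaves a smaller sum system, and `(i₀, f)` is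
the first factor of the factorisation (`IsSumSystem.exists_factor`). As `f ∉ A i₀`, the number `1`
belongs to another part after the division, so neighbouring factors have different indices.
Induction gives `IsSumSystem.exists_factorisation`.

Conversely, the sets `∑_{ℓ : j_ℓ = i} F(ℓ) ⟨f_ℓ⟩` of a factorisation sum to an initial segment of
the natural numbers because of mixed radix expansions (`sum_image_mul_range_eq_range`), and a
comparison of cardinalities determines their sizes (`JointOrderedFactorisation.card_partSet`).

Centring commutes with set sums: the maximum of a set sum is the sum of the maxima
(`JointOrderedFactorisation.centredSet_eq_image`).
-/

/-! ### Two sets with unique sums -/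

/-- Suppose that `A + B` is an initial segment with unique representations, that `A` contains
`0, …, f - 1` but not `f`, and that `0 ∈ B`. Then in the block `{f * k, …, f * k + f - 1}` the set
`B` has at most the element `f * k`, and `A` has all elements of the block or none. The proof
looks at the representation `f * k = a + b`: if neither summand is zero, both lie in earlier
blocks. -/
theorem block_structure {A B : Finset ℕ} {N f : ℕ} (hsum : A + B = Finset.range N)
    (huniq : ∀ a ∈ A, ∀ b ∈ B, ∀ a' ∈ A, ∀ b' ∈ B, a + b = a' + b' → a = a' ∧ b = b')
    (h0 : 0 ∈ B) (hf : 0 < f) (hlt : ∀ r < f, r ∈ A) (hfA : f ∉ A) (k : ℕ) :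
    (∀ s < f, f * k + s ∈ B → s = 0) ∧
      ((∃ s < f, f * k + s ∈ A) → ∀ r < f, f * k + r ∈ A) := by
  have hrep : ∀ x < N, ∃ a ∈ A, ∃ b ∈ B, a + b = x := fun x hx => by
    rwa [← Finset.mem_range, ← hsum, Finset.mem_add] at hx
  have hbound : ∀ a ∈ A, ∀ b ∈ B, a + b < N := fun a ha b hb => by
    rw [← Finset.mem_range, ← hsum]
    exact Finset.add_mem_add ha hb
  have h0A : 0 ∈ A := hlt 0 hf
  -- An element of `B` below `f` also lies in `A`, so `b + 0 = 0 + b` forces `b = 0`.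
  have hBsmall : ∀ b ∈ B, b < f → b = 0 := fun b hb hbf =>
    (huniq b (hlt b hbf) 0 h0 0 h0A b hb (by omega)).1
  have hfB : f < N → f ∈ B := fun hfN => by
    obtain ⟨a, ha, b, hb, hab⟩ := hrep f hfN
    rcases Nat.eq_zero_or_pos a with rfl | hapos
    · rwa [← hab, zero_add]
    · have hb0 := hBsmall b hb (by omega)
      subst hb0
      exact absurd (by rwa [← hab]) hfA
  induction k using Nat.strong_induction_on with
  | _ k ih =>
  rcases Nat.eq_zero_or_pos k with rfl | hk
  · refine ⟨fun s hs hsB => hBsmall s (by simpa using hsB) hs, fun _ r hr => ?_⟩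
    simpa using hlt r hr
  have hfk : f ≤ f * k := Nat.le_mul_of_pos_right f hk
  by_cases hkN : f * k < N
  swap
  · refine ⟨fun s _ hsB => ?_, fun ⟨s, _, hsA⟩ => ?_⟩
    · have := hbound _ h0A _ hsB
      omega
    · have := hbound _ hsA _ h0
      omega
  obtain ⟨a, ha, b, hb, hab⟩ := hrep _ hkN
  rcases Nat.eq_zero_or_pos b with rfl | hbpos
  · -- The case `f * k ∈ A`.
    have hkA : f * k ∈ A := by rwa [← hab]
    have hkf : f * k + f < N := hbound _ hkA _ (hfB (hfk.trans_lt hkN))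
    -- An element `f * k + s` of `B` gives two representations of `f * k + f` (or of `f * k`).
    have hBempty : ∀ s < f, f * k + s ∉ B := fun s hs hsB => by
      rcases Nat.eq_zero_or_pos s with rfl | hspos
      · have := (huniq _ hkA 0 h0 0 h0A _ hsB (by omega)).1
        omega
      · have := (huniq _ hkA f (hfB (by omega)) (f - s) (hlt _ (by omega)) _ hsB (by omega)).1
        omega
    refine ⟨fun s hs hsB => absurd hsB (hBempty s hs), fun _ r hr => ?_⟩
    obtain ⟨a', ha', b', hb', hab'⟩ := hrep (f * k + r) (by omega)
    have hb'k : b' < f * k := by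
      by_contra hle
      refine hBempty (b' - f * k) (by omega) ?_
      rwa [Nat.add_sub_cancel' (by omega)]
    -- Otherwise `a'` starts in an earlier full block, whose first element plus `b'` is `f * k`.
    have ha'k : f * k ≤ a' := by
      by_contra! hlt'
      have hia : a' / f < k := Nat.div_lt_of_lt_mul hlt'
      have hib : b' / f < k := Nat.div_lt_of_lt_mul hb'k
      have hda := Nat.div_add_mod a' f
      have hdb := Nat.div_add_mod b' f
      have hma := Nat.mod_lt a' hf
      have hv := (ih _ hib).1 (b' % f) (Nat.mod_lt _ hf) (by rwa [hdb])
      have hA := (ih _ hia).2 ⟨a' % f, hma, by rwa [hda]⟩ 0 hf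
      have hmod : a' % f = r := by
        have h1 : (a' + b') % f = r := by
          rw [hab', Nat.mul_add_mod, Nat.mod_eq_of_lt hr]
        rwa [Nat.add_mod, hv, add_zero, Nat.mod_mod] at h1
      have := (huniq _ hkA 0 h0 _ hA b' hb' (by omega)).1
      omega
    have := hBsmall b' hb' (by omega)
    rwa [← hab', this, add_zero]
  rcases Nat.eq_zero_or_pos a with rfl | hapos
  · -- The case `f * k ∈ B`.
    have hkB : f * k ∈ B := by rwa [← hab, zero_add]
    refine ⟨fun s hs hsB => ?_, fun ⟨s, hs, hsA⟩ => ?_⟩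
    · exact (huniq s (hlt s hs) _ hkB 0 h0A _ hsB (by omega)).1
    · have := (huniq s (hlt s hs) _ hkB _ hsA 0 h0 (by omega)).2
      omega
  · -- Otherwise the block is covered by sums of elements from earlier blocks.
    have hia : a / f < k := Nat.div_lt_of_lt_mul (by omega)
    have hib : b / f < k := Nat.div_lt_of_lt_mul (by omega)
    have hda := Nat.div_add_mod a f
    have hdb := Nat.div_add_mod b f
    have hv := (ih _ hib).1 (b % f) (Nat.mod_lt _ hf) (by rwa [hdb])
    have hmod : a % f = 0 := by
      have h1 : (a + b) % f = 0 := by rw [hab, Nat.mul_mod_right]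
      rwa [Nat.add_mod, hv, add_zero, Nat.mod_mod] at h1
    have hA := (ih _ hia).2 ⟨a % f, Nat.mod_lt _ hf, by rwa [hda]⟩
    refine ⟨fun s hs hsB => ?_, fun ⟨s, hs, hsA⟩ => ?_⟩
    · have := (huniq _ (hA s hs) b hb 0 h0A _ hsB (by omega)).2
      omega
    · have := (huniq _ (hA s hs) b hb _ hsA 0 h0 (by omega)).2
      omega

/-! ### Set sums -/

theorem Finset.card_sum_le_prod_card {ι M : Type*} [AddCommMonoid M] [DecidableEq M]
    (s : Finset ι) (X : ι → Finset M) : (∑ i ∈ s, X i).card ≤ ∏ i ∈ s, (X i).card := by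
  classical
  induction s using Finset.induction_on with
  | empty => simp
  | insert a s ha ih =>
    rw [Finset.sum_insert ha, Finset.prod_insert ha]
    exact Finset.card_add_le.trans (Nat.mul_le_mul_left _ ih)

theorem Finset.zero_mem_sum {ι M : Type*} [AddCommMonoid M] [DecidableEq M]
    {s : Finset ι} {X : ι → Finset M} (h : ∀ i ∈ s, 0 ∈ X i) : 0 ∈ ∑ i ∈ s, X i := by
  classical
  induction s using Finset.induction_on with
  | empty => simp
  | insert a s ha ih =>
    rw [Finset.sum_insert ha, ← add_zero (0 : M)]
    exact Finset.add_mem_add (h a (Finset.mem_insert_self _ _))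
      (ih fun i hi => h i (Finset.mem_insert_of_mem hi))

theorem Finset.subset_sum_of_zero_mem {ι M : Type*} [AddCommMonoid M] [DecidableEq M]
    {s : Finset ι} {X : ι → Finset M} (h : ∀ i ∈ s, 0 ∈ X i) {i : ι} (hi : i ∈ s) :
    X i ⊆ ∑ i ∈ s, X i := by
  classical
  intro x hx
  rw [← Finset.add_sum_erase s X hi, ← add_zero x]
  exact Finset.add_mem_add hx (Finset.zero_mem_sum fun k hk => h k (Finset.mem_of_mem_erase hk))

theorem Finset.image_sum_of_addHom {ι M M' : Type*} [AddCommMonoid M] [AddCommMonoid M']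
    [DecidableEq M] [DecidableEq M'] (g : M →+ M') (s : Finset ι) (X : ι → Finset M) :
    (∑ i ∈ s, X i).image g = ∑ i ∈ s, (X i).image g :=
  map_sum (Finset.imageAddMonoidHom g) X s

theorem Finset.image_mul_sum {ι R : Type*} [NonUnitalNonAssocSemiring R] [DecidableEq R]
    (c : R) (s : Finset ι) (X : ι → Finset R) :
    (∑ i ∈ s, X i).image (c * ·) = ∑ i ∈ s, (X i).image (c * ·) :=
  Finset.image_sum_of_addHom (AddMonoidHom.mulLeft c) s X

/-- `range f + f * S` is the union of the blocks `{f * s, …, f * s + f - 1}` with `s ∈ S`. -/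
theorem mem_range_add_image_mul {f : ℕ} (hf : 0 < f) {S : Finset ℕ} {x : ℕ} :
    x ∈ Finset.range f + S.image (f * ·) ↔ x / f ∈ S := by
  simp only [Finset.mem_add, Finset.mem_range, Finset.mem_image]
  constructor
  · rintro ⟨r, hr, _, ⟨s, hs, rfl⟩, rfl⟩
    rwa [Nat.add_mul_div_left _ _ hf, Nat.div_eq_of_lt hr, zero_add]
  · exact fun h => ⟨x % f, Nat.mod_lt _ hf, _, ⟨x / f, h, rfl⟩, Nat.mod_add_div x f⟩

theorem range_add_image_mul_range {f : ℕ} (hf : 0 < f) (n : ℕ) :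
    Finset.range f + (Finset.range n).image (f * ·) = Finset.range (f * n) := by
  ext x
  rw [mem_range_add_image_mul hf, Finset.mem_range, Finset.mem_range, Nat.div_lt_iff_lt_mul hf,
    mul_comm]

theorem range_add_image_mul_injective {f : ℕ} (hf : 0 < f) :
    Function.Injective fun S : Finset ℕ => Finset.range f + S.image (f * ·) := by
  intro S T h
  ext x
  have := congrArg (f * x ∈ ·) h
  simpa only [mem_range_add_image_mul hf, Nat.mul_div_cancel_left _ hf, eq_iff_iff] using this

theorem card_range_add_image_mul {f : ℕ} (hf : 0 < f) (S : Finset ℕ) :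
    (Finset.range f + S.image (f * ·)).card = f * S.card := by
  have hinj : Function.Injective (f * · : ℕ → ℕ) := fun a b h => Nat.eq_of_mul_eq_mul_left hf h
  rw [Finset.card_add_iff.mpr, Finset.card_range, Finset.card_image_of_injective _ hinj]
  rintro ⟨r, x⟩ ⟨hr, hx⟩ ⟨r', x'⟩ ⟨hr', hx'⟩ h
  simp only [Finset.coe_range, Set.mem_Iio, Finset.coe_image, Set.mem_image] at hr hx hr' hx' h
  obtain ⟨s, -, rfl⟩ := hx
  obtain ⟨s', -, rfl⟩ := hx'
  have hmod := congrArg (· % f) h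
  simp only [Nat.add_mul_mod_self_left, Nat.mod_eq_of_lt hr, Nat.mod_eq_of_lt hr'] at hmod
  subst hmod
  simpa using h

/-! ### Splitting off the first factor of a sum system -/

namespace IsSumSystem

variable {m : ℕ} {A : Fin m → Finset ℕ}

theorem zero_mem (hA : IsSumSystem A) (i : Fin m) : 0 ∈ A i := by
  have h0 : 0 ∈ ∑ i, A i := by
    rw [hA.sum_eq, Finset.mem_range]
    exact Finset.prod_pos fun i _ => (hA.nonempty i).card_pos
  rw [← Finset.add_sum_erase _ A (Finset.mem_univ i), Finset.mem_add] at h0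
  obtain ⟨a, ha, b, -, hab⟩ := h0
  rwa [← (Nat.add_eq_zero_iff.mp hab).1]

/-- Sums of an element of `A i` and an element of the sum of the other parts are distinct: there
are `∏ j, |A j|` of them, and at most as many pairs. -/
theorem add_injOn (hA : IsSumSystem A) (i : Fin m) :
    Set.InjOn (fun p : ℕ × ℕ => p.1 + p.2)
      ((A i : Set ℕ) ×ˢ ((∑ k ∈ Finset.univ.erase i, A k : Finset ℕ) : Set ℕ)) := by
  rw [← Finset.card_add_iff]
  refine le_antisymm Finset.card_add_le ?_
  rw [Finset.add_sum_erase _ A (Finset.mem_univ i), hA.sum_eq, Finset.card_range,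
    ← Finset.mul_prod_erase _ (fun j => (A j).card) (Finset.mem_univ i)]
  exact Nat.mul_le_mul_left _ (Finset.card_sum_le_prod_card _ _)

/-- If `1` lies in the part `A i₀`, let `f` be the least number outside `A i₀`. Then `A i₀` is a
union of blocks `{f * q, …, f * q + f - 1}`, all other parts consist of multiples of `f`, and
division by `f` gives a smaller sum system. As `f ∉ A i₀`, the number `1` has left the part
`i₀`. -/
theorem exists_factor (hA : IsSumSystem A) {i₀ : Fin m} (h1 : 1 ∈ A i₀) :
    ∃ f, 2 ≤ f ∧ ∃ A' : Fin m → Finset ℕ, IsSumSystem A' ∧ 1 ∉ A' i₀ ∧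
      (∀ i, A i = (if i = i₀ then Finset.range f else 0) + (A' i).image (f * ·)) ∧
      ∀ i, (A i).card = (if i = i₀ then f else 1) * (A' i).card := by
  classical
  have hex : ∃ n, n ∉ A i₀ := Infinite.exists_notMem_finset _
  set f := Nat.find hex with hfdef
  have hfA : f ∉ A i₀ := Nat.find_spec hex
  have hlt : ∀ r < f, r ∈ A i₀ := fun r hr => not_not.mp (Nat.find_min hex hr)
  have hf2 : 2 ≤ f := by
    by_contra! hlt2
    have : f = 0 ∨ f = 1 := by omega
    rcases this with h | h
    · exact hfA (h ▸ hA.zero_mem i₀)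
    · exact hfA (h ▸ h1)
  have hf : 0 < f := by omega
  have hz : ∀ k ∈ Finset.univ.erase i₀, 0 ∈ A k := fun k _ => hA.zero_mem k
  have hblock := block_structure (A := A i₀) (B := ∑ k ∈ Finset.univ.erase i₀, A k)
    ((Finset.add_sum_erase _ A (Finset.mem_univ i₀)).trans hA.sum_eq)
    (fun a ha b hb a' ha' b' hb' h => by
      have := hA.add_injOn i₀ (Set.mk_mem_prod ha hb) (Set.mk_mem_prod ha' hb') h
      simpa using this)
    (Finset.zero_mem_sum hz) hf hlt hfA
  have hEq : ∀ i, A i =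
      (if i = i₀ then Finset.range f else 0) + ((A i).image (· / f)).image (f * ·) := by
    intro i
    split_ifs with hi
    · subst hi
      ext x
      rw [mem_range_add_image_mul hf, Finset.mem_image]
      refine ⟨fun hx => ⟨x, hx, rfl⟩, fun ⟨y, hy, hyx⟩ => ?_⟩
      have := (hblock (y / f)).2 ⟨y % f, Nat.mod_lt _ hf, by rwa [Nat.div_add_mod]⟩
        (x % f) (Nat.mod_lt _ hf)
      rwa [hyx, Nat.div_add_mod] at this
    · have hdvd : ∀ x ∈ A i, f * (x / f) = x := fun x hx => by
        have hxB := Finset.subset_sum_of_zero_mem hz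
          (Finset.mem_erase.mpr ⟨hi, Finset.mem_univ i⟩) hx
        have := (hblock (x / f)).1 (x % f) (Nat.mod_lt _ hf) (by rwa [Nat.div_add_mod])
        have := Nat.div_add_mod x f
        omega
      rw [zero_add, Finset.image_image]
      exact (Finset.image_id.symm).trans (Finset.image_congr fun x hx => (hdvd x hx).symm)
  have hcard : ∀ i, (A i).card = (if i = i₀ then f else 1) * ((A i).image (· / f)).card := by
    intro i
    conv_lhs => rw [hEq i]
    split_ifs
    · exact card_range_add_image_mul hf _
    · rw [zero_add, one_mul, Finset.card_image_of_injective]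
      exact fun a b h => Nat.eq_of_mul_eq_mul_left hf h
  refine ⟨f, hf2, fun i => (A i).image (· / f), ⟨fun i => (hA.nonempty i).image _, ?_⟩, ?_, hEq,
    hcard⟩
  · apply range_add_image_mul_injective hf
    simp only [Finset.image_mul_sum]
    rw [range_add_image_mul_range hf]
    calc Finset.range f + ∑ i, ((A i).image (· / f)).image (f * ·)
        = ∑ i, A i := by
          conv_rhs => rw [Finset.sum_congr rfl fun i _ => hEq i, Finset.sum_add_distrib]
          simp
      _ = _ := by
          rw [hA.sum_eq, Finset.prod_congr rfl fun i _ => hcard i, Finset.prod_mul_distrib]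
          simp
  · intro h
    apply hfA
    rw [hEq i₀, if_pos rfl, mem_range_add_image_mul hf, Nat.div_self hf]
    exact h

end IsSumSystem

/-! ### Mixed radix expansions -/

theorem prod_Iio_succ_cons {L : ℕ} (a : ℕ) (f : Fin L → ℕ) (l : Fin L) :
    ∏ s ∈ Finset.Iio l.succ, (Fin.cons a f : Fin (L + 1) → ℕ) s = a * ∏ s ∈ Finset.Iio l, f s := by
  have h : ∀ (n : ℕ) (l : Fin n) (g : Fin n → ℕ),
      ∏ s ∈ Finset.Iio l, g s = ∏ s, if s < l then g s else 1 := fun n l g => by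
    rw [← Finset.prod_filter]
    congr 1
    ext; simp
  simp [h, Fin.prod_univ_succ]

theorem prod_Iio_zero {L : ℕ} (f : Fin (L + 1) → ℕ) : ∏ s ∈ Finset.Iio 0, f s = 1 :=
  Finset.prod_eq_one fun s hs => absurd (Finset.mem_Iio.mp hs) (Fin.not_lt_zero s)

/-- The digits of mixed radix expansions with bases `f 0, f 1, …` reach every number below the
product of the bases. -/
theorem sum_image_mul_range_eq_range {L : ℕ} (f : Fin L → ℕ) (hf : ∀ l, 0 < f l) :
    ∑ l, (Finset.range (f l)).image ((∏ s ∈ Finset.Iio l, f s) * ·) =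
      Finset.range (∏ l, f l) := by
  induction f using Fin.consInduction with
  | elim0 => rfl
  | cons a f ih =>
    have ha : 0 < a := hf 0
    have hf' : ∀ l, 0 < f l := fun l => by simpa using hf l.succ
    rw [Fin.sum_univ_succ, Fin.prod_univ_succ]
    simp only [prod_Iio_succ_cons, prod_Iio_zero, one_mul, Fin.cons_zero, Fin.cons_succ]
    rw [← range_add_image_mul_range ha, ← ih hf', Finset.image_mul_sum]
    simp [Finset.image_image, Function.comp_def, mul_assoc, Finset.image_id']

/-! ### The parts of a joint ordered factorisation -/

namespace JointOrderedFactorisation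

variable {m : ℕ} {n : Fin m → ℕ}

/-- The set `∑_{ℓ : j_ℓ = i} F(ℓ) ⟨f_ℓ⟩` of natural numbers whose centred version is
`centredSet P i`. -/
def partSet (P : JointOrderedFactorisation n) (i : Fin m) : Finset ℕ :=
  ∑ l with P.j l = i, (Finset.range (P.f l)).image (P.F l * ·)

/-- Prepend the factor `f`, belonging to the index `i₀`, to a joint ordered factorisation whose
first factor belongs to another index. -/
def cons (P : JointOrderedFactorisation n) (i₀ : Fin m) (f : ℕ) (hf : 2 ≤ f)
    (hne : ∀ l : Fin P.L, (l : ℕ) = 0 → P.j l ≠ i₀) {n' : Fin m → ℕ}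
    (hn' : ∀ i, n' i = (if i = i₀ then f else 1) * n i) : JointOrderedFactorisation n' where
  L := P.L + 1
  j := Fin.cons i₀ P.j
  f := Fin.cons f P.f
  two_le := Fin.cases hf P.two_le
  adjacent_ne k l := by
    refine Fin.cases ?_ (fun l => ?_) l
    · intro h; simp at h
    · refine Fin.cases ?_ (fun k => ?_) k
      · intro h; exact hne l (by simpa using h)
      · intro h; exact P.adjacent_ne k l (by simpa using h)
  prod_eq i := by
    rw [hn', ← P.prod_eq, Finset.prod_filter, Finset.prod_filter, Fin.prod_univ_succ]
    simp [eq_comm]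

theorem partSet_cons (P : JointOrderedFactorisation n) {i₀ : Fin m} {f : ℕ} (hf : 2 ≤ f)
    (hne : ∀ l : Fin P.L, (l : ℕ) = 0 → P.j l ≠ i₀) {n' : Fin m → ℕ}
    (hn' : ∀ i, n' i = (if i = i₀ then f else 1) * n i) (i : Fin m) :
    (P.cons i₀ f hf hne hn').partSet i =
      (if i = i₀ then Finset.range f else 0) + (P.partSet i).image (f * ·) := by
  unfold partSet
  rw [Finset.image_mul_sum, Finset.sum_filter, Finset.sum_filter]
  have hF0 : (P.cons i₀ f hf hne hn').F (0 : Fin (P.L + 1)) = 1 := prod_Iio_zero _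
  have hFs : ∀ l : Fin P.L, (P.cons i₀ f hf hne hn').F l.succ = f * P.F l :=
    fun l => prod_Iio_succ_cons f P.f l
  refine (Fin.sum_univ_succ (n := P.L) _).trans
    (congrArg₂ (· + ·) ?_ (Finset.sum_congr rfl fun l _ => ?_))
  · simp only [hF0, one_mul, Finset.image_id', eq_comm (a := i)]
    rfl
  · simp only [hFs, Finset.image_image, Function.comp_def, mul_assoc]
    rfl

/-- The first factor contributes the number `1` to its part. -/
theorem one_mem_partSet (P : JointOrderedFactorisation n) {l : Fin P.L} (hl : (l : ℕ) = 0) :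
    1 ∈ P.partSet (P.j l) := by
  refine Finset.subset_sum_of_zero_mem (i := l) (fun k _ => ?_) (by simp) ?_
  · exact Finset.mem_image.mpr ⟨0, Finset.mem_range.mpr (by have := P.two_le k; omega), mul_zero _⟩
  · refine Finset.mem_image.mpr ⟨1, Finset.mem_range.mpr (P.two_le l), ?_⟩
    rw [mul_one]
    refine Finset.prod_eq_one fun s hs => ?_
    have := Fin.lt_def.mp (Finset.mem_Iio.mp hs)
    omega

theorem sum_partSet (P : JointOrderedFactorisation n) :
    ∑ i, P.partSet i = Finset.range (∏ i, n i) := by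
  have h := Finset.sum_fiberwise (Finset.univ : Finset (Fin P.L)) P.j
    fun l => (Finset.range (P.f l)).image (P.F l * ·)
  have h' := Finset.prod_fiberwise (Finset.univ : Finset (Fin P.L)) P.j P.f
  simp only [P.prod_eq] at h'
  rw [h']
  exact h.trans (sum_image_mul_range_eq_range P.f fun l => by have := P.two_le l; omega)

theorem pos (P : JointOrderedFactorisation n) (i : Fin m) : 0 < n i := by
  rw [← P.prod_eq]
  exact Finset.prod_pos fun l _ => by have := P.two_le l; omega

/-- The bound `|partSet i| ≤ n i` holds for every `i`, and the sum of all parts has `∏ i, n i`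
elements, so no inequality is strict. -/
theorem card_partSet (P : JointOrderedFactorisation n) (i : Fin m) :
    (P.partSet i).card = n i := by
  have hle : ∀ k, (P.partSet k).card ≤ n k := fun k => by
    rw [← P.prod_eq k]
    refine (Finset.card_sum_le_prod_card _ _).trans (Finset.prod_le_prod' fun l _ => ?_)
    exact Finset.card_image_le.trans (Finset.card_range _).le
  have hprod : ∏ k, n k ≤ ∏ k, (P.partSet k).card := by
    have := Finset.card_sum_le_prod_card Finset.univ P.partSet
    rwa [P.sum_partSet, Finset.card_range] at this
  by_contra hne
  have hlt : (P.partSet i).card < n i := lt_of_le_of_ne (hle i) hne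
  have hnpos : 0 < ∏ k, n k := Finset.prod_pos fun k _ => P.pos k
  have hpos : ∀ k ∈ Finset.univ, 0 < (P.partSet k).card := fun k hk =>
    Nat.pos_of_ne_zero (Finset.prod_ne_zero_iff.mp (hnpos.trans_le hprod).ne' k hk)
  exact hprod.not_gt
    (Finset.prod_lt_prod hpos (fun k _ => hle k) ⟨i, Finset.mem_univ i, hlt⟩)

theorem isSumSystem_partSet (P : JointOrderedFactorisation n) : IsSumSystem P.partSet where
  nonempty i := Finset.card_pos.mp (by rw [P.card_partSet]; exact P.pos i)
  sum_eq := by rw [P.sum_partSet]; simp only [P.card_partSet]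

/-! ### Centring -/

theorem isGreatest_partSet (P : JointOrderedFactorisation n) (i : Fin m) :
    IsGreatest (P.partSet i : Set ℕ) (∑ l with P.j l = i, P.F l * (P.f l - 1)) := by
  unfold partSet
  induction (Finset.univ.filter fun l => P.j l = i) using Finset.induction_on with
  | empty => simp [IsGreatest, upperBounds]
  | insert l s hl ih =>
    rw [Finset.sum_insert hl, Finset.sum_insert hl, Finset.coe_add]
    refine ⟨Set.add_mem_add ?_ ih.1, ?_⟩
    · refine Finset.mem_coe.mpr (Finset.mem_image_of_mem _ (Finset.mem_range.mpr ?_))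
      have := P.two_le l
      omega
    · rintro _ ⟨x, hx, y, hy, rfl⟩
      obtain ⟨k, hk, rfl⟩ := Finset.mem_image.mp (Finset.mem_coe.mp hx)
      have := Finset.mem_range.mp hk
      exact add_le_add (Nat.mul_le_mul_left _ (by omega)) (ih.2 hy)

theorem centredSet_eq_image (P : JointOrderedFactorisation n) (i : Fin m)
    (h : (P.partSet i).Nonempty) :
    P.centredSet i =
      (P.partSet i).image fun a : ℕ => (a : ℚ) - ((P.partSet i).max' h : ℚ) / 2 := by
  have hmax : (P.partSet i).max' h = ∑ l with P.j l = i, P.F l * (P.f l - 1) :=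
    ((P.partSet i).isGreatest_max' h).unique (P.isGreatest_partSet i)
  rw [hmax]
  unfold partSet centredSet
  clear hmax h
  induction (Finset.univ.filter fun l => P.j l = i) using Finset.induction_on with
  | empty =>
    simp only [Finset.sum_empty, Nat.cast_zero, zero_div, sub_zero]
    rfl
  | insert l s hl ih =>
    simp only [Finset.sum_insert hl]
    rw [ih]
    have hf : ((P.f l - 1 : ℕ) : ℚ) = (P.f l : ℚ) - 1 :=
      Nat.cast_pred (by have := P.two_le l; omega)
    ext x
    simp only [Finset.mem_add, Finset.mem_image, Nat.cast_add, Nat.cast_mul, hf]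
    constructor
    · rintro ⟨_, ⟨k, hk, rfl⟩, _, ⟨b, hb, rfl⟩, rfl⟩
      refine ⟨_, ⟨_, ⟨k, hk, rfl⟩, b, hb, rfl⟩, ?_⟩
      push_cast
      ring
    · rintro ⟨_, ⟨_, ⟨k, hk, rfl⟩, b, hb, rfl⟩, rfl⟩
      refine ⟨_, ⟨k, hk, rfl⟩, _, ⟨b, hb, rfl⟩, ?_⟩
      push_cast
      ring

theorem centredSet_eq_halvedSet (P : JointOrderedFactorisation n) (i : Fin m) :
    P.centredSet i = P.halvedSet i := by
  unfold centredSet halvedSet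
  rw [Finset.image_mul_sum]
  refine Finset.sum_congr rfl fun l _ => ?_
  rw [Finset.image_image]
  refine Finset.image_congr fun k _ => ?_
  simp only [Function.comp_apply]
  ring

end JointOrderedFactorisation

/-! ### Sum systems and factorisations -/

theorem card_image_natCast_sub (S : Finset ℕ) (c : ℚ) :
    (S.image fun a : ℕ => (a : ℚ) - c).card = S.card :=
  Finset.card_image_of_injective _ fun a b h => by simpa using h

/-- Every sum system comes from a joint ordered factorisation, by induction on the size of the
sum: the part that contains `1` supplies the first factor, and the rest is divided by it. -/
theorem IsSumSystem.exists_factorisation {m : ℕ} {A : Fin m → Finset ℕ} (hA : IsSumSystem A) :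
    ∃ P : JointOrderedFactorisation (fun i => (A i).card), ∀ i, A i = P.partSet i := by
  induction hN : ∏ i, (A i).card using Nat.strong_induction_on generalizing A with
  | _ N ih =>
  have hpos : 0 < ∏ i, (A i).card := Finset.prod_pos fun i _ => (hA.nonempty i).card_pos
  by_cases hN1 : N = 1
  · have hcard : ∀ i, (A i).card = 1 := fun i =>
      Finset.prod_eq_one_iff.mp (hN.trans hN1) i (Finset.mem_univ i)
    refine ⟨⟨0, Fin.elim0, Fin.elim0, fun l => l.elim0, fun k => k.elim0, fun i => ?_⟩,
      fun i => ?_⟩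
    · simp [hcard]
    · obtain ⟨a, ha⟩ := Finset.card_eq_one.mp (hcard i)
      have h0 := hA.zero_mem i
      rw [ha, Finset.mem_singleton] at h0
      rw [ha, ← h0]
      rfl
  -- The number `1` is a sum of elements of the parts, so some part contains it.
  obtain ⟨i₀, h1⟩ : ∃ i, 1 ∈ A i := by
    have h1 : 1 ∈ ((∑ i, A i : Finset ℕ) : Set ℕ) := by
      rw [hA.sum_eq, Finset.mem_coe, Finset.mem_range]
      omega
    rw [Finset.coe_sum, Set.mem_finsetSum] at h1
    obtain ⟨g, hg, hsum⟩ := h1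
    obtain ⟨i, -, hi⟩ := Finset.exists_ne_zero_of_sum_ne_zero (hsum.trans_ne one_ne_zero)
    have hle := Finset.single_le_sum (fun k _ => Nat.zero_le (g k)) (Finset.mem_univ i)
    refine ⟨i, ?_⟩
    rw [← show g i = 1 by omega]
    exact hg (Finset.mem_univ i)
  obtain ⟨f, hf, A', hA', hone, hEq, hcard⟩ := hA.exists_factor h1
  have hNf : N = f * ∏ i, (A' i).card := by
    rw [← hN, Finset.prod_congr rfl fun i _ => hcard i, Finset.prod_mul_distrib]
    simp
  have hpos' : 0 < ∏ i, (A' i).card := Finset.prod_pos fun i _ => (hA'.nonempty i).card_pos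
  obtain ⟨P, hP⟩ := ih _ (by rw [hNf]; nlinarith) hA' rfl
  have hne : ∀ l : Fin P.L, (l : ℕ) = 0 → P.j l ≠ i₀ := fun l hl h => by
    -- The part of the first factor contains `1`, but `1 ∉ A' i₀`.
    apply hone
    rw [← h, hP]
    exact P.one_mem_partSet hl
  refine ⟨P.cons i₀ f hf hne hcard, fun i => ?_⟩
  rw [P.partSet_cons hf hne hcard, ← hP, ← hEq]

theorem mainTheorem6 (m : ℕ) (hm : 1 ≤ m) :
    (∀ C : Fin m → Finset ℚ, IsCentredSumSystem C →
      ∃ P : JointOrderedFactorisation (fun i => (C i).card),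
        ∀ i, C i = P.centredSet i ∧ C i = P.halvedSet i) ∧
    (∀ (n : Fin m → ℕ) (P : JointOrderedFactorisation n),
      IsCentredSumSystem P.centredSet ∧
        (∀ i, (P.centredSet i).card = n i) ∧
        (∀ i, P.centredSet i = P.halvedSet i)) := by
  refine ⟨?_, fun n P => ⟨?_, fun i => ?_, P.centredSet_eq_halvedSet⟩⟩
  · rintro C ⟨A, hA, hC⟩
    obtain ⟨P, hP⟩ := hA.exists_factorisation
    have hcard : (fun i => (C i).card) = fun i => (A i).card := funext fun i => by
      rw [hC i, card_image_natCast_sub]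
    rw [hcard]
    refine ⟨P, fun i => ?_⟩
    have hCP : C i = P.centredSet i := by
      rw [hC i, P.centredSet_eq_image i (hP i ▸ hA.nonempty i)]
      simp only [hP i]
    exact ⟨hCP, hCP.trans (P.centredSet_eq_halvedSet i)⟩
  · exact ⟨P.partSet, P.isSumSystem_partSet, fun i => P.centredSet_eq_image i _⟩
  · rw [P.centredSet_eq_image i (P.isSumSystem_partSet.nonempty i), card_image_natCast_sub,
      P.card_partSet]
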